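/- Let $a_1,d_1,D_w,\kappa_1$ be positive constants with $a_1>d_1$ and $\kappa_1>2\frac{d_1}{a_1-d_1}$, and put $$f(u,w)=\Big(a_1\frac{uw}{1+uw}-d_1\Big)u,\qquad g(u,w)=-w-u^2w+\kappa_1 .$$ Consider the reaction-diffusion-ODE system $$u_t=f(u,w)\quad (x\in[0,1],\ t>0),\qquad w_t=D_w w_{xx}+g(u,w)\quad (x\in(0,1),\ t>0),$$ with homogeneous Neumann boundary conditions $w_x(0,t)=w_x(1,t)=0$. A steady state is a pair of real-valued functions $(U,W)\in L^\infty(0,1)\times H^1(0,1)$ such that $1+UW\neq 0$ and $f(U,W)=0$ almost everywhere in $(0,1)$, and $D_wW_{xx}+g(U,W)=0$ weakly with homogeneous Neumann boundary conditions, i.e. $D_w\int_0^1W_x\varphi_x\,dx=\int_0^1 g(U,W)\varphi\,dx$ for all $\varphi\in H^1(0,1)$. The linearization of the system at $(U,W)$ is the operator $$\mathcal L(\varphi,\psi)=\big(f_u(U,W)\varphi+f_w(U,W)\psi,\ D_w\psi_{xx}+g_u(U,W)\varphi+g_w(U,W)\psi\big)$$ on the complex space $L^2(0,1)\times L^2(0,1)$,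 with domain $L^2(0,1)\times\{\psi\in H^2(0,1):\psi_x(0)=\psi_x(1)=0\}$. The steady state is called linearly unstable if the spectrum of $\mathcal L$ contains a point with positive real part. **Theorem.** Every steady state $(U,W)\in L^\infty(0,1)\times H^1(0,1)$ for which $U>0$ on a subset of $(0,1)$ of positive Lebesgue measure is linearly unstable. -/

import Mathlib

open MeasureTheory

noncomputable section

namespace ReactionDiffusionODE

/-- Lebesgue measure on the open interval `(0,1)`. -/
abbrev μI : Measure ℝ := volume.restrict (Set.Ioo (0 : ℝ) 1)

/-! ### Sobolev space `H¹(0,1)` and the weak Neumann Laplacian -/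

/-- Test functions: real-valued smooth functions with compact support inside `(0,1)`. -/
def IsTestFunction (φ : ℝ → ℝ) : Prop :=
  ContDiff ℝ (⊤ : ℕ∞) φ ∧ HasCompactSupport φ ∧ tsupport φ ⊆ Set.Ioo (0 : ℝ) 1

/-- `g` is a weak (distributional) derivative of `f` on `(0,1)`. -/
def HasWeakDeriv {E : Type*} [NormedAddCommGroup E] [NormedSpace ℝ E] (f g : ℝ → E) : Prop :=
  ∀ φ : ℝ → ℝ, IsTestFunction φ → ∫ x, deriv φ x • f x ∂μI = -∫ x, φ x • g x ∂μI

/-- `f ∈ H¹(0,1)` with weak derivative `g`. -/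
structure IsH1With {E : Type*} [NormedAddCommGroup E] [NormedSpace ℝ E] (f g : ℝ → E) :
    Prop where
  memLp : MemLp f 2 μI
  memLp_deriv : MemLp g 2 μI
  hasWeakDeriv : HasWeakDeriv f g

/-- `f ∈ H¹(0,1)`. -/
def MemH1 {E : Type*} [NormedAddCommGroup E] [NormedSpace ℝ E] (f : ℝ → E) : Prop :=
  ∃ g : ℝ → E, IsH1With f g

/-- `f ∈ H¹(0,1)`, `h ∈ L²(0,1)` and `f_xx = h` with homogeneous Neumann boundary conditions, in
the weak sense: `∫ φ' f' = - ∫ φ h` for all `φ ∈ H¹(0,1)`. The test functions `φ` do not have to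
vanish at `0` and `1`, which encodes `f_x(0) = f_x(1) = 0`. -/
def IsNeumannLaplacian {E : Type*} [NormedAddCommGroup E] [NormedSpace ℝ E] (f h : ℝ → E) :
    Prop :=
  MemLp h 2 μI ∧ ∃ f' : ℝ → E, IsH1With f f' ∧
    ∀ φ φ' : ℝ → ℝ, IsH1With φ φ' → ∫ x, φ' x • f' x ∂μI = -∫ x, φ x • h x ∂μI

/-! ### The system `u_t = f(u,w)`, `w_t = D_w w_xx + g(u,w)` -/

/-- The kinetics of `u`: `f(u,w) = (a₁ uw / (1 + uw) - d₁) u`. -/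
def fKin (a₁ d₁ u w : ℝ) : ℝ := (a₁ * (u * w / (1 + u * w)) - d₁) * u

/-- The kinetics of `w`: `g(u,w) = -w - u² w + κ₁`. -/
def gKin (κ₁ u w : ℝ) : ℝ := -w - u ^ 2 * w + κ₁

/-- `(U,W) ∈ L^∞(0,1) × H¹(0,1)` is a (weak) steady state of the system with homogeneous Neumann
boundary conditions for `w`. -/
structure IsSteadyState (a₁ d₁ D_w κ₁ : ℝ) (U W : ℝ → ℝ) : Prop where
  memLp_U : MemLp U ⊤ μI
  memH1_W : MemH1 W
  eq_u : ∀ᵐ x ∂μI, 1 + U x * W x ≠ 0 ∧ fKin a₁ d₁ (U x) (W x) = 0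
  eq_w : ∃ h : ℝ → ℝ, IsNeumannLaplacian W h ∧ ∀ᵐ x ∂μI, D_w * h x + gKin κ₁ (U x) (W x) = 0

/-! ### Linearization -/

/-- Complex `L²(0,1)`. -/
abbrev L2 : Type := Lp ℂ 2 μI

/-- `∂f/∂u` at `(u,w)`. -/
def fu (a₁ d₁ u w : ℝ) : ℝ := deriv (fun s => fKin a₁ d₁ s w) u

/-- `∂f/∂w` at `(u,w)`. -/
def fw (a₁ d₁ u w : ℝ) : ℝ := deriv (fun s => fKin a₁ d₁ u s) w

/-- `∂g/∂u` at `(u,w)`. -/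
def gu (κ₁ u w : ℝ) : ℝ := deriv (fun s => gKin κ₁ s w) u

/-- `∂g/∂w` at `(u,w)`. -/
def gw (κ₁ u w : ℝ) : ℝ := deriv (fun s => gKin κ₁ u s) w

/-- `((φ,ψ),(p,q))` belongs to the graph of the linearization of the right-hand side at `(U,W)`:
`p = f_u φ + f_w ψ` and `q = D_w ψ_xx + g_u φ + g_w ψ`, with `ψ` in the domain of the Neumann
Laplacian on `L²(0,1)`. -/
def InLinearizationGraph (a₁ d₁ D_w κ₁ : ℝ) (U W : ℝ → ℝ) (z : (L2 × L2) × (L2 × L2)) : Prop :=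
  (∀ᵐ x ∂μI, z.2.1 x =
    (fu a₁ d₁ (U x) (W x) : ℂ) * z.1.1 x + (fw a₁ d₁ (U x) (W x) : ℂ) * z.1.2 x) ∧
  ∃ h : ℝ → ℂ, IsNeumannLaplacian (z.1.2 : ℝ → ℂ) h ∧
    ∀ᵐ x ∂μI, z.2.2 x = (D_w : ℂ) * h x +
      (gu κ₁ (U x) (W x) : ℂ) * z.1.1 x + (gw κ₁ (U x) (W x) : ℂ) * z.1.2 x

lemma IsTestFunction.bdd {φ : ℝ → ℝ} (hφ : IsTestFunction φ) : MemLp φ ⊤ μI :=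
  (hφ.1.continuous.memLp_top_of_hasCompactSupport hφ.2.1 volume).restrict _

lemma IsTestFunction.deriv_bdd {φ : ℝ → ℝ} (hφ : IsTestFunction φ) : MemLp (deriv φ) ⊤ μI :=
  ((hφ.1.continuous_deriv (by simp)).memLp_top_of_hasCompactSupport hφ.2.1.deriv volume).restrict _

lemma integrable_smul_of_memLp {E : Type*} [NormedAddCommGroup E] [NormedSpace ℝ E]
    {φ : ℝ → ℝ} {f : ℝ → E} (hφ : MemLp φ 2 μI) (hf : MemLp f 2 μI) :
    Integrable (fun x => φ x • f x) μI :=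
  memLp_one_iff_integrable.1 (hf.smul (p := 2) (q := 2) (r := 1) hφ)

lemma IsTestFunction.memLp {φ : ℝ → ℝ} (hφ : IsTestFunction φ) : MemLp φ 2 μI :=
  hφ.bdd.mono_exponent le_top

lemma IsTestFunction.deriv_memLp {φ : ℝ → ℝ} (hφ : IsTestFunction φ) : MemLp (deriv φ) 2 μI :=
  hφ.deriv_bdd.mono_exponent le_top

/-- The weak derivative of a test function is its derivative. -/
lemma IsTestFunction.isH1With {φ : ℝ → ℝ} (hφ : IsTestFunction φ) : IsH1With φ (deriv φ) := by
  refine ⟨hφ.memLp, hφ.deriv_memLp, fun χ hχ => ?_⟩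
  have h1 : ∫ x, deriv χ x • φ x ∂μI = ∫ x, deriv χ x * φ x := by
    refine setIntegral_eq_integral_of_forall_compl_eq_zero fun x hx => ?_
    simp [image_eq_zero_of_notMem_tsupport fun h => hx (hφ.2.2 h)]
  have h2 : ∫ x, χ x • deriv φ x ∂μI = ∫ x, χ x * deriv φ x := by
    refine setIntegral_eq_integral_of_forall_compl_eq_zero fun x hx => ?_
    simp [image_eq_zero_of_notMem_tsupport fun h => hx (hχ.2.2 h)]
  have cφ := hφ.1.continuous
  have cχ := hχ.1.continuous
  have cφ' := hφ.1.continuous_deriv (by simp)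
  have cχ' := hχ.1.continuous_deriv (by simp)
  rw [h1, h2, integral_mul_deriv_eq_deriv_mul_of_integrable (u := χ) (v := φ)
    (u' := deriv χ) (v' := deriv φ)
    (fun x _ => (hχ.1.differentiable (by simp) x).hasDerivAt)
    (fun x _ => (hφ.1.differentiable (by simp) x).hasDerivAt)
    ((cχ.mul cφ').integrable_of_hasCompactSupport hχ.2.1.mul_right)
    ((cχ'.mul cφ).integrable_of_hasCompactSupport hφ.2.1.mul_left)
    ((cχ.mul cφ).integrable_of_hasCompactSupport hχ.2.1.mul_right), neg_neg]

/-- The fundamental lemma of the calculus of variations on `(0,1)`. -/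
lemma ae_eq_zero_of_test {E : Type*} [NormedAddCommGroup E] [NormedSpace ℝ E] [CompleteSpace E]
    {f : ℝ → E} (hf : MemLp f 2 μI)
    (h : ∀ φ : ℝ → ℝ, IsTestFunction φ → ∫ x, φ x • f x ∂μI = 0) : f =ᵐ[μI] 0 := by
  have hloc : LocallyIntegrableOn f (Set.Ioo (0 : ℝ) 1) volume :=
    IntegrableOn.locallyIntegrableOn (hf.integrable (by norm_num))
  have := isOpen_Ioo.ae_eq_zero_of_integral_contDiff_smul_eq_zero hloc (fun g g1 g2 g3 => by
    rw [← h g ⟨g1, g2, g3⟩]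
    refine (setIntegral_eq_integral_of_forall_compl_eq_zero fun x hx => ?_).symm
    simp [image_eq_zero_of_notMem_tsupport fun h => hx (g3 h)])
  exact (ae_restrict_iff' measurableSet_Ioo).2 this

lemma IsNeumannLaplacian.congr {f f₁ h : ℝ → ℂ} (hf : IsNeumannLaplacian f h)
    (e : f =ᵐ[μI] f₁) : IsNeumannLaplacian f₁ h := by
  obtain ⟨hh, f', H, hφ⟩ := hf
  refine ⟨hh, f', ⟨H.memLp.ae_eq e, H.memLp_deriv, fun φ hφ => ?_⟩, hφ⟩
  rw [← H.hasWeakDeriv φ hφ]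
  exact integral_congr_ae (e.mono fun x hx => by simp only [hx])

lemma IsNeumannLaplacian.add {f₁ f₂ h₁ h₂ : ℝ → ℂ} (H₁ : IsNeumannLaplacian f₁ h₁)
    (H₂ : IsNeumannLaplacian f₂ h₂) : IsNeumannLaplacian (f₁ + f₂) (h₁ + h₂) := by
  obtain ⟨m₁, g₁, w₁, t₁⟩ := H₁
  obtain ⟨m₂, g₂, w₂, t₂⟩ := H₂
  refine ⟨m₁.add m₂, g₁ + g₂, ⟨w₁.memLp.add w₂.memLp, w₁.memLp_deriv.add w₂.memLp_deriv,
    fun φ hφ => ?_⟩, fun φ φ' hφ => ?_⟩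
  · simp only [Pi.add_apply, smul_add]
    rw [integral_add (integrable_smul_of_memLp hφ.deriv_memLp w₁.memLp)
      (integrable_smul_of_memLp hφ.deriv_memLp w₂.memLp),
      integral_add (integrable_smul_of_memLp hφ.memLp w₁.memLp_deriv)
      (integrable_smul_of_memLp hφ.memLp w₂.memLp_deriv), w₁.hasWeakDeriv φ hφ,
      w₂.hasWeakDeriv φ hφ, neg_add]
  · simp only [Pi.add_apply, smul_add]
    rw [integral_add (integrable_smul_of_memLp hφ.memLp_deriv w₁.memLp_deriv)
      (integrable_smul_of_memLp hφ.memLp_deriv w₂.memLp_deriv),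
      integral_add (integrable_smul_of_memLp hφ.memLp m₁)
      (integrable_smul_of_memLp hφ.memLp m₂), t₁ φ φ' hφ, t₂ φ φ' hφ, neg_add]

lemma IsNeumannLaplacian.const_smul {f h : ℝ → ℂ} (c : ℂ) (H : IsNeumannLaplacian f h) :
    IsNeumannLaplacian (c • f) (c • h) := by
  obtain ⟨m, g, w, t⟩ := H
  refine ⟨m.const_smul c, c • g, ⟨w.memLp.const_smul c, w.memLp_deriv.const_smul c,
    fun φ hφ => ?_⟩, fun φ φ' hφ => ?_⟩
  · simp only [Pi.smul_apply, smul_comm _ c]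
    rw [integral_smul, integral_smul, w.hasWeakDeriv φ hφ, smul_neg]
  · simp only [Pi.smul_apply, smul_comm _ c]
    rw [integral_smul, integral_smul, t φ φ' hφ, smul_neg]

/-- The weak Neumann Laplacian is single-valued. -/
lemma IsNeumannLaplacian.eq_zero {f h : ℝ → ℂ} (H : IsNeumannLaplacian f h) (hf : f =ᵐ[μI] 0) :
    h =ᵐ[μI] 0 := by
  obtain ⟨m, g, w, t⟩ := H
  have hg : g =ᵐ[μI] 0 := ae_eq_zero_of_test w.memLp_deriv fun φ hφ => by
    have h0 : ∫ x, deriv φ x • f x ∂μI = 0 := by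
      rw [integral_congr_ae (g := fun _ => (0 : ℂ)) (hf.mono fun x hx => by simp [hx])]
      simp
    have := w.hasWeakDeriv φ hφ
    rw [h0] at this
    exact neg_eq_zero.1 this.symm
  refine ae_eq_zero_of_test m fun φ hφ => ?_
  have h0 : ∫ x, deriv φ x • g x ∂μI = 0 := by
    rw [integral_congr_ae (g := fun _ => (0 : ℂ)) (hg.mono fun x hx => by simp [hx])]
    simp
  have := t φ (deriv φ) hφ.isH1With
  rw [h0] at this
  exact neg_eq_zero.1 this.symm

lemma L2_zero_ae : ∀ᵐ x ∂μI, (0 : L2) x = 0 := Lp.coeFn_zero ℂ 2 μI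

/-- The graph of the linearization at `(U,W)`, as a subspace. -/
def linearizationGraph (a₁ d₁ D_w κ₁ : ℝ) (U W : ℝ → ℝ) :
    Submodule ℂ ((L2 × L2) × (L2 × L2)) where
  carrier := {z | InLinearizationGraph a₁ d₁ D_w κ₁ U W z}
  zero_mem' := by
    refine ⟨?_, 0, ⟨MemLp.zero, 0, ⟨Lp.memLp _, MemLp.zero, fun φ _ => ?_⟩, fun φ φ' _ => ?_⟩, ?_⟩
    · filter_upwards [L2_zero_ae] with x hx
      simp only [Prod.fst_zero, Prod.snd_zero, hx, mul_zero, add_zero, Pi.zero_apply]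
    · rw [integral_congr_ae (g := fun _ => (0 : ℂ))
        (L2_zero_ae.mono fun x hx => by simp only [Prod.fst_zero, Prod.snd_zero, hx, smul_zero])]
      simp
    · simp
    · filter_upwards [L2_zero_ae] with x hx
      simp only [Prod.fst_zero, Prod.snd_zero, hx, mul_zero, add_zero, Pi.zero_apply]
  add_mem' := by
    rintro ⟨⟨φ₁, ψ₁⟩, p₁, q₁⟩ ⟨⟨φ₂, ψ₂⟩, p₂, q₂⟩ ⟨e₁, h₁, n₁, k₁⟩ ⟨e₂, h₂, n₂, k₂⟩
    refine ⟨?_, h₁ + h₂, (n₁.add n₂).congr (Lp.coeFn_add ψ₁ ψ₂).symm, ?_⟩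
    · filter_upwards [e₁, e₂, Lp.coeFn_add φ₁ φ₂, Lp.coeFn_add ψ₁ ψ₂, Lp.coeFn_add p₁ p₂]
        with x a b c d e
      simp only [Prod.mk_add_mk, Pi.add_apply] at *
      rw [c, d, e, a, b]; ring
    · filter_upwards [k₁, k₂, Lp.coeFn_add φ₁ φ₂, Lp.coeFn_add ψ₁ ψ₂, Lp.coeFn_add q₁ q₂]
        with x a b c d e
      simp only [Prod.mk_add_mk, Pi.add_apply] at *
      rw [c, d, e, a, b]; ring
  smul_mem' := by
    rintro r ⟨⟨φ, ψ⟩, p, q⟩ ⟨e₁, h, n, k⟩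
    refine ⟨?_, r • h, (n.const_smul r).congr (Lp.coeFn_smul r ψ).symm, ?_⟩
    · filter_upwards [e₁, Lp.coeFn_smul r φ, Lp.coeFn_smul r ψ, Lp.coeFn_smul r p] with x a b c d
      simp only [Prod.smul_mk, Pi.smul_apply, smul_eq_mul] at *
      rw [b, c, d, a]; ring
    · filter_upwards [k, Lp.coeFn_smul r φ, Lp.coeFn_smul r ψ, Lp.coeFn_smul r q] with x a b c d
      simp only [Prod.smul_mk, Pi.smul_apply, smul_eq_mul] at *
      rw [b, c, d, a]; ring

/-- `linearizationGraph` is the graph of an operator. -/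
lemma linearizationGraph_singleValued (a₁ d₁ D_w κ₁ : ℝ) (U W : ℝ → ℝ)
    (z : (L2 × L2) × (L2 × L2)) (hz : z ∈ linearizationGraph a₁ d₁ D_w κ₁ U W)
    (h0 : z.1 = 0) : z.2 = 0 := by
  obtain ⟨⟨φ, ψ⟩, p, q⟩ := z
  obtain ⟨e, h, n, k⟩ := hz
  obtain ⟨rfl, rfl⟩ := Prod.mk.inj h0
  have hh := n.eq_zero (Lp.coeFn_zero ℂ 2 μI)
  refine Prod.ext ?_ ?_ <;> refine Lp.eq_zero_iff_ae_eq_zero.2 ?_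
  · filter_upwards [e, L2_zero_ae] with x a b
    simpa only [b, mul_zero, add_zero, Pi.zero_apply] using a
  · filter_upwards [k, hh, L2_zero_ae] with x a b c
    simpa only [b, c, mul_zero, add_zero, Pi.zero_apply] using a

/-- The linearization of the system at `(U,W)`: the unbounded operator
`(φ,ψ) ↦ (f_u φ + f_w ψ, D_w ψ_xx + g_u φ + g_w ψ)` on `L²(0,1) × L²(0,1)`, with homogeneous Neumann
boundary conditions for `ψ`. -/
def linearization (a₁ d₁ D_w κ₁ : ℝ) (U W : ℝ → ℝ) : (L2 × L2) →ₗ.[ℂ] (L2 × L2) :=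
  (linearizationGraph a₁ d₁ D_w κ₁ U W).toLinearPMap

lemma linearization_graph (a₁ d₁ D_w κ₁ : ℝ) (U W : ℝ → ℝ) :
    (linearization a₁ d₁ D_w κ₁ U W).graph = linearizationGraph a₁ d₁ D_w κ₁ U W :=
  Submodule.toLinearPMap_graph_eq _ (linearizationGraph_singleValued a₁ d₁ D_w κ₁ U W)

/-- The resolvent set of an unbounded operator `A`: the `z` for which `z - A` is a bijection from
the domain of `A` onto the space, with a bounded inverse. -/
def unboundedResolventSet {X : Type*} [NormedAddCommGroup X] [NormedSpace ℂ X] (A : X →ₗ.[ℂ] X) :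
    Set ℂ :=
  {z | ∃ R : X →L[ℂ] X,
    (∀ y : X, ∃ hy : R y ∈ A.domain, z • R y - A ⟨R y, hy⟩ = y) ∧
    ∀ x : A.domain, R (z • (x : X) - A x) = x}

/-- The spectrum of an unbounded operator. -/
def unboundedSpectrum {X : Type*} [NormedAddCommGroup X] [NormedSpace ℂ X] (A : X →ₗ.[ℂ] X) :
    Set ℂ := (unboundedResolventSet A)ᶜ

/-- `(U,W)` is linearly unstable: the spectrum of the linearization at `(U,W)` meets the open right
half-plane. -/
def IsLinearlyUnstable (a₁ d₁ D_w κ₁ : ℝ) (U W : ℝ → ℝ) : Prop :=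
  ∃ z ∈ unboundedSpectrum (linearization a₁ d₁ D_w κ₁ U W), 0 < z.re

end ReactionDiffusionODE

end

/-!
The instability is caused by autocatalysis of the non-diffusing component `u`. Where `U ≠ 0`, the
equation `f(U,W) = 0` forces `UW / (1 + UW) = d₁ / a₁`, and there `f_u(U,W)` is the positive
constant `lam = d₁ (a₁ - d₁) / a₁` (`fu_eq_of_fKin_eq_zero`), while
`f_w(U,W) = (a₁ - d₁)² / a₁ * U²` (`fw_eq_of_fKin_eq_zero`) is bounded. This `lam` lies in the
spectrum because `lam - L` is not surjective. Indeed, let `(φ,ψ)` solve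
`(lam - L) (φ,ψ) = (p,0)`. On `{U > 0}` the terms containing `φ` cancel in the first component and
`p = - f_w(U,W) ψ` remains. Since `ψ ∈ H¹(0,1)` is essentially bounded (`IsH1With.exists_ae_bound`),
so is `p` on `{U > 0}`. But `p(x) = |x - x₀| ^ (-1/4)` belongs to `L²(0,1)`
(`memLp_abs_sub_rpow`) and is essentially unbounded on `{U > 0}` if `x₀` is chosen such that
`{U > 0}` has positive measure in every neighbourhood of `x₀` (`not_ae_abs_sub_rpow_le`).

The embedding of `H¹(0,1)` in `L^∞(0,1)` is proved through the lemma of du Bois-Reymond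
(`ae_eq_const_of_hasWeakDeriv_zero`): a function in `H¹(0,1)` differs by a constant from the
primitive of its weak derivative.
-/

open ReactionDiffusionODE

namespace ReactionDiffusionODE

/-! ### Test functions on `(0,1)` -/

/-- A test function with integral zero is the derivative of a test function. -/
lemma IsTestFunction.exists_primitive {χ : ℝ → ℝ} (hχ : IsTestFunction χ)
    (h0 : ∫ x, χ x ∂μI = 0) : ∃ Φ : ℝ → ℝ, IsTestFunction Φ ∧ deriv Φ = χ := by
  obtain ⟨hs, hc, ht⟩ := hχ
  have hcont := hs.continuous
  -- The point `1/2` is inserted to make the compact set nonempty.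
  have hK : IsCompact (insert (1 / 2 : ℝ) (tsupport χ)) := IsCompact.insert hc _
  obtain ⟨a, haK, ha⟩ := hK.exists_isLeast (Set.insert_nonempty _ _)
  obtain ⟨b, hbK, hb⟩ := hK.exists_isGreatest (Set.insert_nonempty _ _)
  have hKsub : insert (1 / 2 : ℝ) (tsupport χ) ⊆ Set.Ioo 0 1 :=
    Set.insert_subset (by norm_num) ht
  have ha01 := hKsub haK
  have hb01 := hKsub hbK
  have hzl : ∀ x < a, χ x = 0 := fun x hx => image_eq_zero_of_notMem_tsupport fun h =>
    absurd (ha (Set.mem_insert_of_mem _ h)) (not_le.2 hx)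
  have hzr : ∀ x, b < x → χ x = 0 := fun x hx => image_eq_zero_of_notMem_tsupport fun h =>
    absurd (hb (Set.mem_insert_of_mem _ h)) (not_le.2 hx)
  have hd : ∀ x, HasDerivAt (fun x => ∫ t in (0 : ℝ)..x, χ t) (χ x) x := fun x =>
    intervalIntegral.integral_hasDerivAt_right (hcont.intervalIntegrable _ _)
      (hcont.stronglyMeasurableAtFilter _ _) hcont.continuousAt
  have hderiv : deriv (fun x => ∫ t in (0 : ℝ)..x, χ t) = χ := funext fun x => (hd x).deriv
  have hfull : ∫ t in (0 : ℝ)..1, χ t = 0 := by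
    rw [intervalIntegral.integral_of_le zero_le_one, integral_Ioc_eq_integral_Ioo]
    exact h0
  have hsub : tsupport (fun x => ∫ t in (0 : ℝ)..x, χ t) ⊆ Set.Icc a b := by
    refine closure_minimal (fun x hx => ?_) isClosed_Icc
    by_contra hnot
    refine hx ?_
    rw [Set.mem_Icc, not_and_or, not_le, not_le] at hnot
    rcases hnot with h | h
    · refine intervalIntegral.integral_zero_ae (ae_of_all _ fun t ht' => hzl t ?_)
      rcases Set.mem_uIoc.1 ht' with h' | h'
      · exact h'.2.trans_lt h
      · exact h'.2.trans_lt ha01.1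
    · have h1 : ∫ t in (1 : ℝ)..x, χ t = 0 := by
        refine intervalIntegral.integral_zero_ae (ae_of_all _ fun t ht' => hzr t ?_)
        rcases Set.mem_uIoc.1 ht' with h' | h'
        · exact hb01.2.trans h'.1
        · exact h.trans h'.1
      have := intervalIntegral.integral_add_adjacent_intervals
        (hcont.intervalIntegrable (μ := volume) 0 1) (hcont.intervalIntegrable 1 x)
      rw [h1, hfull, add_zero] at this
      exact this.symm
  refine ⟨fun x => ∫ t in (0 : ℝ)..x, χ t, ⟨?_, ?_, ?_⟩, hderiv⟩
  · exact contDiff_infty_iff_deriv.2 ⟨fun x => (hd x).differentiableAt, by rwa [hderiv]⟩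
  · exact isCompact_Icc.of_isClosed_subset (isClosed_tsupport _) hsub
  · exact hsub.trans fun x hx => ⟨ha01.1.trans_le hx.1, hx.2.trans_lt hb01.2⟩

lemma exists_isTestFunction_integral_eq_one :
    ∃ χ : ℝ → ℝ, IsTestFunction χ ∧ ∫ x, χ x ∂μI = 1 := by
  let B : ContDiffBump (1 / 2 : ℝ) := ⟨1 / 8, 1 / 4, by norm_num, by norm_num⟩
  have hsub : tsupport (B.normed volume) ⊆ Set.Ioo (0 : ℝ) 1 := by
    rw [B.tsupport_normed_eq, Real.closedBall_eq_Icc]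
    intro x hx
    have h1 : (1 / 2 - 1 / 4 : ℝ) ≤ x := hx.1
    have h2 : x ≤ (1 / 2 + 1 / 4 : ℝ) := hx.2
    constructor <;> linarith
  refine ⟨B.normed volume, ⟨B.contDiff_normed, B.hasCompactSupport_normed, hsub⟩, ?_⟩
  refine Eq.trans ?_ (B.integral_normed (μ := volume))
  exact setIntegral_eq_integral_of_forall_compl_eq_zero fun x hx =>
    image_eq_zero_of_notMem_tsupport fun h => hx (hsub h)

lemma IsTestFunction.sub_const_mul {φ χ : ℝ → ℝ} (hφ : IsTestFunction φ) (hχ : IsTestFunction χ)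
    (c : ℝ) : IsTestFunction (fun x => φ x - c * χ x) := by
  have hz : ∀ x, x ∉ tsupport φ ∪ tsupport χ → φ x - c * χ x = 0 := fun x hx => by
    rw [image_eq_zero_of_notMem_tsupport fun h => hx (Or.inl h),
      image_eq_zero_of_notMem_tsupport fun h => hx (Or.inr h)]
    simp
  have hsub : tsupport (fun x => φ x - c * χ x) ⊆ tsupport φ ∪ tsupport χ :=
    closure_minimal (fun x hx => by_contra fun h => hx (hz x h))
      ((isClosed_tsupport _).union (isClosed_tsupport _))
  exact ⟨hφ.1.sub (contDiff_const.mul hχ.1),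
    (IsCompact.union hφ.2.1 hχ.2.1).of_isClosed_subset (isClosed_tsupport _) hsub,
    hsub.trans (Set.union_subset hφ.2.2 hχ.2.2)⟩

/-! ### Weak derivatives and boundedness of `H¹` functions -/

/-- The lemma of du Bois-Reymond. Every test function is the sum of a multiple of a fixed one with
integral `1` and of the derivative of another test function. -/
lemma ae_eq_const_of_hasWeakDeriv_zero {f : ℝ → ℝ} (hf : MemLp f 2 μI)
    (h : HasWeakDeriv f 0) : ∃ c : ℝ, ∀ᵐ x ∂μI, f x = c := by
  obtain ⟨χ, hχ, hχ1⟩ := exists_isTestFunction_integral_eq_one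
  have hfc : ∀ c : ℝ, MemLp (fun x => f x - c) 2 μI := fun c => hf.sub (memLp_const c)
  refine ⟨∫ x, χ x • f x ∂μI, ?_⟩
  refine (ae_eq_zero_of_test (hfc (∫ x, χ x • f x ∂μI)) fun φ hφ => ?_).mono
    fun x hx => sub_eq_zero.1 hx
  have iφ : Integrable φ μI := hφ.memLp.integrable (by norm_num)
  have iχ : Integrable χ μI := hχ.memLp.integrable (by norm_num)
  have iφf := integrable_smul_of_memLp hφ.memLp hf
  have iχf := integrable_smul_of_memLp hχ.memLp hf
  obtain ⟨Φ, hΦ, hΦ'⟩ := (hφ.sub_const_mul hχ (∫ x, φ x ∂μI)).exists_primitive (by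
    rw [integral_sub iφ (iχ.const_mul _), integral_const_mul, hχ1, mul_one, sub_self])
  have key := h Φ hΦ
  simp only [hΦ', smul_eq_mul, sub_mul, Pi.zero_apply, mul_zero, integral_zero, neg_zero,
    mul_assoc, mul_sub] at key iφf iχf ⊢
  rw [integral_sub iφf (iχf.const_mul _), integral_const_mul] at key
  rw [integral_sub iφf (iφ.mul_const _), integral_mul_const]
  exact key

/-- Integration by parts for the absolutely continuous primitive of an integrable function. -/
lemma hasWeakDeriv_intervalIntegral {g : ℝ → ℝ} (hg : IntervalIntegrable g volume 0 1) :
    HasWeakDeriv (fun x => ∫ t in (0 : ℝ)..x, g t) g := by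
  intro φ hφ
  have hG := hg.absolutelyContinuousOnInterval_intervalIntegral (c := 0) (by simp)
  have hΦ : AbsolutelyContinuousOnInterval φ 0 1 :=
    (hφ.1.contDiffOn.of_le (by norm_cast)).absolutelyContinuousOnInterval
  have hφ0 : φ 0 = 0 := image_eq_zero_of_notMem_tsupport fun h => lt_irrefl _ (hφ.2.2 h).1
  have hφ1 : φ 1 = 0 := image_eq_zero_of_notMem_tsupport fun h => lt_irrefl _ (hφ.2.2 h).2
  have hparts := hΦ.integral_mul_deriv_eq_deriv_mul hG
  have hgd : ∫ x in (0 : ℝ)..1, φ x * deriv (fun x => ∫ t in (0 : ℝ)..x, g t) x =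
      ∫ x in (0 : ℝ)..1, φ x * g x := by
    refine intervalIntegral.integral_congr_ae ?_
    filter_upwards [hg.ae_hasDerivAt_integral] with x hx hx'
    rw [(hx (Set.uIoc_subset_uIcc hx') 0 (by simp)).deriv]
  rw [hgd, hφ0, hφ1] at hparts
  simp only [intervalIntegral.integral_of_le zero_le_one, integral_Ioc_eq_integral_Ioo] at hparts
  simp only [smul_eq_mul]
  linarith

/-- The embedding of `H¹(0,1)` in `L^∞(0,1)`. -/
lemma IsH1With.exists_ae_bound {f g : ℝ → ℝ} (H : IsH1With f g) :
    ∃ M : ℝ, ∀ᵐ x ∂μI, |f x| ≤ M := by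
  have hg : IntervalIntegrable g volume 0 1 := by
    rw [intervalIntegrable_iff_integrableOn_Ioo_of_le zero_le_one]
    exact H.memLp_deriv.integrable (by norm_num)
  have hGc : ContinuousOn (fun x => ∫ t in (0 : ℝ)..x, g t) (Set.Icc 0 1) := by
    simpa using (hg.absolutelyContinuousOnInterval_intervalIntegral (c := 0) (by simp)).continuousOn
  obtain ⟨C, hC⟩ := isCompact_Icc.exists_bound_of_continuousOn hGc
  have hIoo : ∀ᵐ x ∂μI, x ∈ Set.Ioo (0 : ℝ) 1 := ae_restrict_mem measurableSet_Ioo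
  have hGm : MemLp (fun x => ∫ t in (0 : ℝ)..x, g t) 2 μI :=
    MemLp.of_bound ((hGc.mono Set.Ioo_subset_Icc_self).aestronglyMeasurable measurableSet_Ioo) C
      (hIoo.mono fun x hx => hC x (Set.Ioo_subset_Icc_self hx))
  have hw : HasWeakDeriv (fun x => f x - ∫ t in (0 : ℝ)..x, g t) 0 := fun φ hφ => by
    have h1 := H.hasWeakDeriv φ hφ
    have h2 := hasWeakDeriv_intervalIntegral hg φ hφ
    simp only [smul_sub]
    rw [integral_sub (integrable_smul_of_memLp hφ.deriv_memLp H.memLp)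
      (integrable_smul_of_memLp hφ.deriv_memLp hGm), h1, h2]
    simp
  obtain ⟨c, hc⟩ := ae_eq_const_of_hasWeakDeriv_zero (H.memLp.sub hGm) hw
  refine ⟨|c| + C, ?_⟩
  filter_upwards [hc, hIoo] with x hx hx'
  have hx₂ : f x = c + ∫ t in (0 : ℝ)..x, g t := sub_eq_iff_eq_add.1 hx
  rw [hx₂]
  exact (abs_add_le _ _).trans (by gcongr; exact hC x (Set.Ioo_subset_Icc_self hx'))

lemma IsH1With.re {f g : ℝ → ℂ} (H : IsH1With f g) :
    IsH1With (fun x => (f x).re) (fun x => (g x).re) := by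
  refine ⟨H.memLp.re, H.memLp_deriv.re, fun φ hφ => ?_⟩
  have hre : ∀ {χ : ℝ → ℝ} {k : ℝ → ℂ}, MemLp χ 2 μI → MemLp k 2 μI →
      ∫ x, χ x • (k x).re ∂μI = (∫ x, χ x • k x ∂μI).re := fun hχ hk => by
    rw [← RCLike.re_eq_complex_re, ← integral_re (integrable_smul_of_memLp hχ hk)]
    simp
  rw [hre hφ.deriv_memLp H.memLp, hre hφ.memLp H.memLp_deriv, H.hasWeakDeriv φ hφ, Complex.neg_re]

/-! ### An unbounded function in `L²(0,1)` -/

lemma memLp_abs_sub_rpow (x₀ : ℝ) :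
    MemLp (fun x => |x - x₀| ^ (-(1 / 4) : ℝ)) 2 μI := by
  have hm : Measurable fun x : ℝ => |x - x₀| ^ (-(1 / 4) : ℝ) := by fun_prop
  rw [memLp_two_iff_integrable_sq hm.aestronglyMeasurable]
  have hsq : ∀ x : ℝ, (|x - x₀| ^ (-(1 / 4) : ℝ)) ^ 2 = |x - x₀| ^ (-(1 / 2) : ℝ) := fun x => by
    rw [← Real.rpow_natCast, ← Real.rpow_mul (abs_nonneg _)]
    norm_num
  simp only [hsq]
  have hI : IntervalIntegrable (fun x : ℝ => |x| ^ (-(1 / 2) : ℝ)) volume (0 - x₀) (1 - x₀) := by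
    refine intervalIntegrable_of_even (fun x => by rw [abs_neg]) fun x hx => ?_
    refine (intervalIntegral.intervalIntegrable_rpow' (by norm_num : (-1 : ℝ) < -(1 / 2))).congr ?_
    intro y hy
    rw [Set.uIoc_of_le hx.le] at hy
    simp only [abs_of_pos hy.1]
  have := hI.comp_sub_right x₀
  simp only [sub_add_cancel] at this
  exact (intervalIntegrable_iff_integrableOn_Ioo_of_le zero_le_one).1 this

open scoped Topology in
/-- The negative power `|x - x₀| ^ (-1/4)` is essentially unbounded on every set that has positive
measure near `x₀`. -/
lemma not_ae_abs_sub_rpow_le {S : Set ℝ} {x₀ : ℝ} (hS : ∀ t ∈ 𝓝[S] x₀, 0 < volume t) (K : ℝ) :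
    ¬ ∀ᵐ x, x ∈ S → |x - x₀| ^ (-(1 / 4) : ℝ) ≤ K := by
  intro hK
  have hδ : 0 < 1 / (|K| + 1) ^ 4 := by positivity
  refine (hS (S ∩ Metric.ball x₀ (1 / (|K| + 1) ^ 4))
    (inter_mem_nhdsWithin S (Metric.ball_mem_nhds x₀ hδ))).ne' ?_
  refine measure_eq_zero_iff_ae_notMem.2 ?_
  filter_upwards [hK, Measure.ae_ne volume x₀] with x hx hne hmem
  have hr : 0 < |x - x₀| := abs_pos.2 (sub_ne_zero.2 hne)
  have hlt : |x - x₀| < 1 / (|K| + 1) ^ 4 := by simpa [Real.dist_eq] using hmem.2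
  have hle : |x - x₀| ^ (-(1 / 4) : ℝ) ≤ |K| + 1 := by linarith [hx hmem.1, le_abs_self K]
  have h4 : (|x - x₀| ^ (-(1 / 4) : ℝ)) ^ 4 = |x - x₀|⁻¹ := by
    rw [← Real.rpow_natCast, ← Real.rpow_mul hr.le, ← Real.rpow_neg_one]
    norm_num
  have h5 : |x - x₀|⁻¹ ≤ (|K| + 1) ^ 4 := h4 ▸ pow_le_pow_left₀ (by positivity) hle 4
  rw [lt_one_div hr (by positivity), one_div] at hlt
  exact absurd h5 (not_le.2 hlt)

/-! ### Partial derivatives of the kinetics where `u ≠ 0` and `f(u,w) = 0` -/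

lemma mul_one_add_eq_of_fKin_eq_zero {a₁ d₁ u w : ℝ} (hu : u ≠ 0) (hs : 1 + u * w ≠ 0)
    (hf : fKin a₁ d₁ u w = 0) : (a₁ - d₁) * (1 + u * w) = a₁ := by
  have hk := (mul_eq_zero.1 hf).resolve_right hu
  rw [mul_div_assoc', sub_eq_zero, div_eq_iff hs] at hk
  linear_combination hk

lemma fu_eq_of_fKin_eq_zero {a₁ d₁ u w : ℝ} (hu : u ≠ 0) (hs : 1 + u * w ≠ 0)
    (hf : fKin a₁ d₁ u w = 0) (ha : a₁ ≠ 0) : fu a₁ d₁ u w = d₁ * (a₁ - d₁) / a₁ := by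
  have hk := mul_one_add_eq_of_fKin_eq_zero hu hs hf
  have h1 : HasDerivAt (fun s : ℝ => s * w) w u := by
    simpa using (hasDerivAt_id u).mul_const w
  have hD := (((h1.div (h1.const_add 1) hs).const_mul a₁).sub_const d₁).mul (hasDerivAt_id u)
  have h0 : a₁ * (u * w / (1 + u * w)) - d₁ = 0 := (mul_eq_zero.1 hf).resolve_right hu
  have hval : a₁ * ((w * (1 + u * w) - u * w * w) / (1 + u * w) ^ 2) * u =
      d₁ * (a₁ - d₁) / a₁ := by
    rw [mul_div_assoc', div_mul_eq_mul_div, div_eq_div_iff (pow_ne_zero 2 hs) ha]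
    linear_combination (a₁ - d₁ * (1 + u * w)) * hk
  rw [fu]
  refine hD.deriv.trans ?_
  simp only [Pi.div_apply, id_eq, mul_one]
  rw [h0, add_zero]
  exact hval

lemma fw_eq_of_fKin_eq_zero {a₁ d₁ u w : ℝ} (hu : u ≠ 0) (hs : 1 + u * w ≠ 0)
    (hf : fKin a₁ d₁ u w = 0) (ha : a₁ ≠ 0) : fw a₁ d₁ u w = (a₁ - d₁) ^ 2 / a₁ * u ^ 2 := by
  have hk := mul_one_add_eq_of_fKin_eq_zero hu hs hf
  have h1 : HasDerivAt (fun s : ℝ => u * s) u w := by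
    simpa using (hasDerivAt_id w).const_mul u
  have hD := (((h1.div (h1.const_add 1) hs).const_mul a₁).sub_const d₁).mul_const u
  rw [fw]
  refine hD.deriv.trans ?_
  rw [mul_div_assoc', div_mul_eq_mul_div, div_mul_eq_mul_div, div_eq_div_iff (pow_ne_zero 2 hs) ha]
  linear_combination (-u ^ 2 * (a₁ + (a₁ - d₁) * (1 + u * w))) * hk

end ReactionDiffusionODE

/-! ### Instability -/

theorem theorem3p3 (a₁ d₁ D_w κ₁ : ℝ) (hd₁ : 0 < d₁) (hD_w : 0 < D_w) (ha₁ : d₁ < a₁)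
    (hκ₁ : 2 * (d₁ / (a₁ - d₁)) < κ₁) (U W : ℝ → ℝ)
    (hUW : ReactionDiffusionODE.IsSteadyState a₁ d₁ D_w κ₁ U W)
    (hU : 0 < MeasureTheory.volume {x ∈ Set.Ioo (0 : ℝ) 1 | 0 < U x}) :
    ReactionDiffusionODE.IsLinearlyUnstable a₁ d₁ D_w κ₁ U W := by
  have ha : 0 < a₁ := hd₁.trans ha₁
  refine ⟨((d₁ * (a₁ - d₁) / a₁ : ℝ) : ℂ), ?_, ?_⟩
  swap
  · rw [Complex.ofReal_re]
    exact div_pos (mul_pos hd₁ (sub_pos.2 ha₁)) ha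
  rintro ⟨R, hR, -⟩
  obtain ⟨x₀, -, hx₀⟩ := exists_mem_forall_mem_nhdsWithin_pos_measure hU.ne'
  let p : L2 := (memLp_abs_sub_rpow x₀).ofReal.toLp _
  have hp : ∀ᵐ x ∂μI, p x = ((|x - x₀| ^ (-(1 / 4) : ℝ) : ℝ) : ℂ) := MemLp.coeFn_toLp _
  -- The resolvent equation is solved with right-hand side `(p, 0)`.
  obtain ⟨⟨φ, ψ⟩, ⟨b, q⟩, hsol, hfst, h, ⟨-, ψ', hψ, -⟩, -⟩ : ∃ X A : L2 × L2,
      ((d₁ * (a₁ - d₁) / a₁ : ℝ) : ℂ) • X - A = (p, 0) ∧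
        InLinearizationGraph a₁ d₁ D_w κ₁ U W (X, A) := by
    obtain ⟨hy, hsol⟩ := hR (p, 0)
    have hgraph := (linearization a₁ d₁ D_w κ₁ U W).mem_graph ⟨R (p, 0), hy⟩
    rw [linearization_graph] at hgraph
    exact ⟨_, _, hsol, hgraph⟩
  obtain ⟨M, hM⟩ := hψ.re.exists_ae_bound
  obtain ⟨N, hN⟩ : ∃ N : ℝ, ∀ᵐ x ∂μI, ‖U x‖ ≤ N :=
    ⟨_, (ae_le_eLpNormEssSup (f := U)).mono fun x hx => by
      have hfin : eLpNormEssSup U μI ≠ ⊤ := by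
        simpa [eLpNorm_exponent_top] using hUW.memLp_U.eLpNorm_ne_top
      simpa using ENNReal.toReal_mono hfin hx⟩
  have hcomp : ∀ᵐ x ∂μI, ((d₁ * (a₁ - d₁) / a₁ : ℝ) : ℂ) * φ x - b x = p x := by
    have hsol₁ : ((d₁ * (a₁ - d₁) / a₁ : ℝ) : ℂ) • φ - b = p := congrArg Prod.fst hsol
    filter_upwards [Lp.coeFn_sub (((d₁ * (a₁ - d₁) / a₁ : ℝ) : ℂ) • φ) b,
      Lp.coeFn_smul ((d₁ * (a₁ - d₁) / a₁ : ℝ) : ℂ) φ] with x h1 h2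
    rw [← hsol₁, h1, Pi.sub_apply, h2, Pi.smul_apply, smul_eq_mul]
  refine not_ae_abs_sub_rpow_le hx₀ ((a₁ - d₁) ^ 2 / a₁ * N ^ 2 * M) ?_
  have hall : ∀ᵐ x ∂μI, 0 < U x →
      |x - x₀| ^ (-(1 / 4) : ℝ) ≤ (a₁ - d₁) ^ 2 / a₁ * N ^ 2 * M := by
    filter_upwards [hp, hfst, hcomp, hM, hN, hUW.eq_u] with x hpx hfx hcx hMx hNx hux hpos
    rw [fu_eq_of_fKin_eq_zero hpos.ne' hux.1 hux.2 ha.ne',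
      fw_eq_of_fKin_eq_zero hpos.ne' hux.1 hux.2 ha.ne'] at hfx
    -- The coefficient of `φ` cancels, since `f_u` equals the spectral parameter where `U ≠ 0`.
    rw [hfx, hpx, sub_add_cancel_left] at hcx
    have hre := congrArg Complex.re hcx
    rw [Complex.neg_re, Complex.re_ofReal_mul, Complex.ofReal_re] at hre
    rw [← hre]
    refine (neg_le_abs _).trans ?_
    have hM0 : 0 ≤ M := (abs_nonneg _).trans hMx
    rw [abs_mul, abs_of_nonneg (by positivity)]
    rw [Real.norm_of_nonneg hpos.le] at hNx
    gcongr
  filter_upwards [(ae_restrict_iff' measurableSet_Ioo).1 hall] with x hx hxS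
  exact hx hxS.1 hxS.2
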